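/- Let $\mathscr A$ be an alphabet of arbitrary cardinality and let $X\subseteq\mathscr A^{\mathbb N}$ be a one-sided subshift, i.e. the set of all sequences in which no word of some set $F\subseteq\mathscr A^*$ occurs. Let $\mathcal L_X$ be the set of finite words (including the empty word $\omega$) occurring in elements of $X$. For $\alpha,\beta\in\mathcal L_X$ put $C(\alpha,\beta)=\{\beta x\in X:\alpha x\in X\}$ and $F_\alpha=C(\alpha,\omega)$; for finite $P\subseteq\mathcal L_X$ put $F_P=\bigcap_{\alpha\in P}F_\alpha$ (with $F_\emptyset=X$). Let $\mathcal U$ be the Boolean algebra of subsets of $X$ generated by all $C(\alpha,\beta)$, $\alpha,\beta\in\mathcal L_X$, and let $\widehat{\mathcal U}$ be its Stone dual, i.e. the set of ultrafilters of $\mathcal U$ with the topology having the sets $O_A=\{\xi: A\in\xi\}$, $A\in\mathcal U$, as a basis. For $A\subseteq X$ let $r(A,\alpha)=\{x\in X:\alpha x\in A\}$. Let $\mathbb F$ be the free group on $\mathscr A$, with the discrete topology, and let $\widehat\varphi$ be the partial action of $\mathbb F$ on $\widehat{\mathcal U}$ with domains $V_{\beta\alpha^{-1}}=O_{C(\alpha,\beta)}$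 and maps $\widehat\varphi_{\alpha\beta^{-1}}\colon V_{\beta\alpha^{-1}}\to V_{\alpha\beta^{-1}}$, $$\widehat\varphi_{\alpha\beta^{-1}}(\xi)=\{A\in\mathcal U: r(B,\beta)\subseteq r(A,\alpha)\text{ for some }B\in\xi\},$$ for $\alpha,\beta\in\mathcal L_X$ with $\alpha\beta^{-1}$ in reduced form, and $V_t=\emptyset$ for all $t\in\mathbb F$ not of this form. Let $\mathcal G=\mathbb F\ltimes_{\widehat\varphi}\widehat{\mathcal U}=\{(\xi,t,\eta):\eta\in V_{t^{-1}},\ \xi=\widehat\varphi_t(\eta)\}$ be the transformation groupoid, with the topology induced from $\widehat{\mathcal U}\times\mathbb F\times\widehat{\mathcal U}$, the operations $(\xi,s,\eta)(\eta,t,\gamma)=(\xi,st,\gamma)$ and $(\xi,t,\eta)^{-1}=(\eta,t^{-1},\xi)$, and unit space $\mathcal G^{(0)}=\{(\xi,e,\xi)\}$. The following are equivalent: 1. $X$ satisfies condition (L): for every finite set $P\subseteq\mathcal L_X$ and every nonempty word $\gamma\in\mathcal L_X$ with $\gamma^\infty\in F_P$, the set $F_P$ contains an element other than $\gamma^\infty$;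 2. $\{x\}\notin\mathcal U$ for every eventually periodic point $x\in X$, i.e. every $x\in X$ of the form $x=\alpha\beta^\infty$ with $\alpha,\beta$ words and $\beta$ nonempty; 3. $\mathcal G$ is effective: the interior of the isotropy bundle $\{(\xi,t,\eta)\in\mathcal G:\xi=\eta\}$ equals $\mathcal G^{(0)}$; 4. the partial action $\widehat\varphi$ is topologically free: for every $t\in\mathbb F$ with $t\neq e$, the set $\{\xi\in V_{t^{-1}}:\widehat\varphi_t(\xi)\neq\xi\}$ is dense in $V_{t^{-1}}$. Moreover, if $\mathscr A$ is countable (finite or countably infinite), then these conditions are also equivalent to 5. $\mathcal G$ is topologically principal: the set of units with trivial isotropy is dense in $\mathcal G^{(0)}$. -/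

import Mathlib

/-! ### Topological groupoids -/

/-- A topological groupoid, presented by its space of arrows `𝒢`; the units are the arrows of the
form `source g`.  The product `mul g h _` is defined when `source g = range h`. -/
structure TopGroupoid (𝒢 : Type*) [TopologicalSpace 𝒢] where
  source : 𝒢 → 𝒢
  range : 𝒢 → 𝒢
  mul : (g h : 𝒢) → source g = range h → 𝒢
  inv : 𝒢 → 𝒢
  source_source : ∀ g, source (source g) = source g
  range_source : ∀ g, range (source g) = source g
  source_range : ∀ g, source (range g) = range g
  range_range : ∀ g, range (range g) = range g
  source_mul : ∀ g h w, source (mul g h w) = source h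
  range_mul : ∀ g h w, range (mul g h w) = range g
  mul_assoc : ∀ (g h k : 𝒢) (w₁ : source g = range h) (w₂ : source h = range k),
    mul (mul g h w₁) k ((source_mul g h w₁).trans w₂) =
      mul g (mul h k w₂) (w₁.trans (range_mul h k w₂).symm)
  mul_source : ∀ g, mul g (source g) (range_source g).symm = g
  range_mul_self : ∀ g, mul (range g) g (source_range g) = g
  source_inv : ∀ g, source (inv g) = range g
  range_inv : ∀ g, range (inv g) = source g
  inv_mul : ∀ g, mul (inv g) g (source_inv g) = source g
  mul_inv : ∀ g, mul g (inv g) (range_inv g).symm = range g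
  continuous_inv : Continuous inv
  continuous_mul : Continuous fun p : {p : 𝒢 × 𝒢 // source p.1 = range p.2} =>
    mul p.1.1 p.1.2 p.2

namespace TopGroupoid

variable {𝒢 : Type*} [TopologicalSpace 𝒢] (S : TopGroupoid 𝒢)

/-- The unit space of the groupoid. -/
def units : Set 𝒢 := {u | S.source u = u}

/-- The isotropy bundle. -/
def iso : Set 𝒢 := {g | S.range g = S.source g}

/-- The interior of the isotropy bundle is the unit space. -/
def IsEffective : Prop := interior S.iso = S.units

/-- The units with trivial isotropy. -/
def unitsWithTrivialIsotropy : Set 𝒢 :=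
  {u | u ∈ S.units ∧ ∀ g, S.source g = u → S.range g = u → g = u}

/-- The units with trivial isotropy are dense in the unit space. -/
def IsTopologicallyPrincipal : Prop := S.units ⊆ closure S.unitsWithTrivialIsotropy

end TopGroupoid

/-! ### Topological partial actions of discrete groups and their transformation groupoids -/

/-- A topological partial action of a discrete group `G` on `Z`: open sets `dom g` and continuous
maps `dom g⁻¹ → dom g`, such that the identity acts as the identity of `Z` and the map of `g * h`
extends the composition of the maps of `g` and `h`.  (It follows that the maps of `g` and `g⁻¹` are
mutually inverse homeomorphisms.)  The values of `map g` outside `dom g⁻¹` carry no meaning. -/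
structure TopPartialAction (G Z : Type*) [Group G] [TopologicalSpace Z] where
  dom : G → Set Z
  map : G → Z → Z
  isOpen_dom : ∀ g, IsOpen (dom g)
  map_mem : ∀ g, ∀ x ∈ dom g⁻¹, map g x ∈ dom g
  continuousOn_map : ∀ g, ContinuousOn (map g) (dom g⁻¹)
  dom_one : dom 1 = Set.univ
  map_one : ∀ x, map 1 x = x
  map_mul : ∀ g h x, x ∈ dom h⁻¹ → map h x ∈ dom g⁻¹ →
    x ∈ dom (g * h)⁻¹ ∧ map (g * h) x = map g (map h x)

namespace TopPartialAction

variable {G Z : Type*} [Group G] [TopologicalSpace Z] (θ : TopPartialAction G Z)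

/-- For every `g ≠ 1` the points of `dom g⁻¹` that `g` moves are dense in `dom g⁻¹`. -/
def IsTopologicallyFree : Prop :=
  ∀ g : G, g ≠ 1 → θ.dom g⁻¹ ⊆ closure {x | x ∈ θ.dom g⁻¹ ∧ θ.map g x ≠ x}

theorem map_inv_map (g : G) (x : Z) (hx : x ∈ θ.dom g⁻¹) : θ.map g⁻¹ (θ.map g x) = x := by
  have h := θ.map_mul g⁻¹ g x hx (by simpa using θ.map_mem g x hx)
  rw [← h.2, inv_mul_cancel, θ.map_one]

/-- The arrows `(ξ, t, η)` of the transformation groupoid. -/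
def Arrow : Type _ :=
  {p : Z × G × Z // p.2.2 ∈ θ.dom p.2.1⁻¹ ∧ p.1 = θ.map p.2.1 p.2.2}

/-- The topology induced by the product topology of `Z × G × Z`, with `G` discrete. -/
instance : TopologicalSpace θ.Arrow :=
  TopologicalSpace.induced Subtype.val
    (@instTopologicalSpaceProd Z (G × Z) _ (@instTopologicalSpaceProd G Z ⊥ _))

/-- The unit `(ξ, 1, ξ)`. -/
def unitArrow (ξ : Z) : θ.Arrow :=
  ⟨(ξ, 1, ξ), by simp [θ.dom_one], by simp [θ.map_one]⟩

/-- The transformation groupoid `G ⋉ Z`, with `(ξ, s, η) (η, t, γ) = (ξ, s t, γ)` and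
`(ξ, t, η)⁻¹ = (η, t⁻¹, ξ)`. -/
def transformationGroupoid : TopGroupoid θ.Arrow where
  source p := θ.unitArrow p.1.2.2
  range p := θ.unitArrow p.1.1
  mul p q w := ⟨(p.1.1, p.1.2.1 * q.1.2.1, q.1.2.2), by
    have e : p.1.2.2 = q.1.1 := congrArg (fun a : θ.Arrow => a.1.1) w
    have h := θ.map_mul p.1.2.1 q.1.2.1 q.1.2.2 q.2.1 (by rw [← q.2.2, ← e]; exact p.2.1)
    exact ⟨h.1, by rw [h.2, ← q.2.2, ← e]; exact p.2.2⟩⟩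
  inv p := ⟨(p.1.2.2, p.1.2.1⁻¹, p.1.1), by
    refine ⟨?_, ?_⟩
    · simp only [inv_inv]
      rw [p.2.2]; exact θ.map_mem _ _ p.2.1
    · simp only
      rw [p.2.2, θ.map_inv_map _ _ p.2.1]⟩
  source_source _ := rfl
  range_source _ := rfl
  source_range _ := rfl
  range_range _ := rfl
  source_mul _ _ _ := rfl
  range_mul _ _ _ := rfl
  mul_assoc _ _ _ _ _ := Subtype.ext (by simp [mul_assoc])
  mul_source _ := Subtype.ext (by simp [unitArrow])
  range_mul_self _ := Subtype.ext (by simp [unitArrow])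
  source_inv _ := rfl
  range_inv _ := rfl
  inv_mul _ := Subtype.ext (by simp [unitArrow])
  mul_inv _ := Subtype.ext (by simp [unitArrow])
  continuous_inv := by
    let _ : TopologicalSpace G := ⊥
    have _ : DiscreteTopology G := ⟨rfl⟩
    have hv : Continuous (Subtype.val : θ.Arrow → Z × G × Z) := continuous_induced_dom
    refine continuous_induced_rng.2 ?_
    exact (hv.snd.snd).prodMk ((continuous_of_discreteTopology.comp hv.snd.fst).prodMk hv.fst)
  continuous_mul := by
    let _ : TopologicalSpace G := ⊥
    have _ : DiscreteTopology G := ⟨rfl⟩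
    have hv : Continuous (Subtype.val : θ.Arrow → Z × G × Z) := continuous_induced_dom
    refine continuous_induced_rng.2 ?_
    have h1 := hv.comp (continuous_fst.comp (continuous_subtype_val
      (p := fun p : θ.Arrow × θ.Arrow => θ.unitArrow p.1.1.2.2 = θ.unitArrow p.2.1.1)))
    have h2 := hv.comp (continuous_snd.comp (continuous_subtype_val
      (p := fun p : θ.Arrow × θ.Arrow => θ.unitArrow p.1.1.2.2 = θ.unitArrow p.2.1.1)))
    have hm : Continuous fun p : G × G => p.1 * p.2 := continuous_of_discreteTopology
    exact h1.fst.prodMk ((hm.comp (h1.snd.fst.prodMk h2.snd.fst)).prodMk h2.snd.snd)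

end TopPartialAction

/-! ### The Stone dual of a Boolean algebra -/

/-- The Stone dual of a Boolean algebra: the set of its ultrafilters. -/
@[ext]
structure StoneDual (B : Type*) [BooleanAlgebra B] where
  carrier : Set B
  top_mem : ⊤ ∈ carrier
  bot_notMem : ⊥ ∉ carrier
  inf_mem : ∀ a ∈ carrier, ∀ b ∈ carrier, a ⊓ b ∈ carrier
  mem_of_le : ∀ a ∈ carrier, ∀ b, a ≤ b → b ∈ carrier
  mem_or_compl_mem : ∀ a, a ∈ carrier ∨ aᶜ ∈ carrier

namespace StoneDual

variable {B : Type*} [BooleanAlgebra B]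

/-- The basic set `O_a` of all ultrafilters that contain `a`. -/
def basicOpen (a : B) : Set (StoneDual B) := {ξ | a ∈ ξ.carrier}

/-- The topology with basis the sets `O_a`. -/
instance : TopologicalSpace (StoneDual B) :=
  TopologicalSpace.generateFrom (Set.range basicOpen)

theorem isOpen_basicOpen (a : B) : IsOpen (basicOpen a) :=
  TopologicalSpace.isOpen_generateFrom_of_mem ⟨a, rfl⟩

theorem eq_of_subset {ξ η : StoneDual B} (h : ξ.carrier ⊆ η.carrier) : ξ = η := by
  refine StoneDual.ext (h.antisymm fun a ha => ?_)
  refine (ξ.mem_or_compl_mem a).resolve_right fun hc => η.bot_notMem ?_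
  have := η.inf_mem _ ha _ (h hc)
  rwa [inf_compl_eq_bot] at this

end StoneDual

/-! ### Subshifts -/

/-- A one-sided subshift over the alphabet `𝒜`: the set of all sequences in which no word of some
set `F` of forbidden words occurs. -/
structure Subshift (𝒜 : Type*) where
  carrier : Set (Stream' 𝒜)
  exists_forbidden : ∃ F : Set (List 𝒜), carrier = {x | ∀ i n, (x.drop i).take n ∉ F}

/-- A sequence of the form `α β^∞` with a nonempty word `β`. -/
def IsEventuallyPeriodic {𝒜 : Type*} (x : Stream' 𝒜) : Prop :=
  ∃ (α β : List 𝒜) (h : β ≠ []), x = α ++ₛ Stream'.cycle β h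

/-- The word `α β⁻¹` in the letters of `𝒜` and their formal inverses. -/
def fracWord {𝒜 : Type*} (α β : List 𝒜) : List (𝒜 × Bool) :=
  α.map (fun a => (a, true)) ++ (β.map (fun a => (a, false))).reverse

/-- `t = α β⁻¹` in the free group, and `α β⁻¹` is in reduced form. -/
def IsReducedForm {𝒜 : Type*} (t : FreeGroup 𝒜) (α β : List 𝒜) : Prop :=
  t = FreeGroup.mk (fracWord α β) ∧ FreeGroup.IsReduced (fracWord α β)

namespace Subshift

variable {𝒜 : Type*} (X : Subshift 𝒜)

/-- The points of the subshift. -/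
abbrev Point : Type _ := {x : Stream' 𝒜 // x ∈ X.carrier}

/-- The set of all words that occur in the subshift. -/
def language : Set (List 𝒜) := {w | ∃ x ∈ X.carrier, ∃ n, w = x.take n}

/-- `C(α, β) = {β x ∈ X : α x ∈ X}`. -/
def C (α β : List 𝒜) : Set X.Point :=
  {y | ∃ x : Stream' 𝒜, y.1 = β ++ₛ x ∧ α ++ₛ x ∈ X.carrier}

/-- The follower set `F_α = C(α, ω)`. -/
def follower (α : List 𝒜) : Set X.Point := X.C α []

/-- The follower set `F_P` of a set of words; `F_∅` is the whole subshift. -/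
def followerSet (P : Finset (List 𝒜)) : Set X.Point := ⋂ α ∈ P, X.follower α

/-- Condition (L): if a finite set `P` of words of the language and a nonempty word `γ` of the
language are such that `γ^∞ ∈ F_P`, then `F_P` has an element other than `γ^∞`. -/
def ConditionL : Prop :=
  ∀ P : Finset (List 𝒜), (∀ α ∈ P, α ∈ X.language) →
    ∀ γ ∈ X.language, ∀ hγ : γ ≠ [], ∀ y ∈ X.followerSet P, y.1 = Stream'.cycle γ hγ →
      ∃ z ∈ X.followerSet P, z ≠ y

/-- The Boolean algebra `𝒰` of subsets of the subshift generated by the sets `C(α, β)`. -/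
def U : BooleanSubalgebra (Set X.Point) :=
  BooleanSubalgebra.closure {A | ∃ α ∈ X.language, ∃ β ∈ X.language, A = X.C α β}

/-- The relative range `r(A, α) = {x ∈ X : α x ∈ A}`. -/
def relRange (A : Set X.Point) (α : List 𝒜) : Set X.Point :=
  {x | ∃ y ∈ A, y.1 = α ++ₛ x.1}

/-- The Stone dual of `𝒰`. -/
abbrev hatU : Type _ := StoneDual X.U

/-- The domain `V_t`: it is `O_{C(α, β)}` if `t = β α⁻¹` in reduced form with `α`, `β` in the
language, and it is empty if `t` is not of this form. -/
def V (t : FreeGroup 𝒜) : Set X.hatU :=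
  {ξ | ∃ α ∈ X.language, ∃ β ∈ X.language, IsReducedForm t β α ∧
    ∃ A : X.U, (A : Set X.Point) = X.C α β ∧ A ∈ ξ.carrier}

/-- For `t = α β⁻¹` in reduced form with `α`, `β` in the language, the set
`{A ∈ 𝒰 : r(B, β) ⊆ r(A, α) for some B ∈ ξ}`. -/
def phiCarrier (t : FreeGroup 𝒜) (ξ : X.hatU) : Set X.U :=
  {A | ∃ α ∈ X.language, ∃ β ∈ X.language, IsReducedForm t α β ∧
    ∃ B ∈ ξ.carrier, X.relRange B β ⊆ X.relRange A α}

/-! #### Auxiliary facts: `φ̂` is a partial action by homeomorphisms -/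

variable {X}

theorem append_mem {α : List 𝒜} {x : Stream' 𝒜} (h : α ++ₛ x ∈ X.carrier) : x ∈ X.carrier := by
  obtain ⟨F, hF⟩ := X.exists_forbidden
  rw [hF] at h ⊢
  intro i n
  have := h (α.length + i) n
  rwa [← Stream'.drop_drop, Stream'.drop_append_stream] at this

theorem mem_language {α : List 𝒜} {x : Stream' 𝒜} (h : α ++ₛ x ∈ X.carrier) : α ∈ X.language :=
  ⟨_, h, α.length, by simp [Stream'.take_append_of_le_length]⟩

theorem C_mem (α β : List 𝒜) : X.C α β ∈ X.U := by
  by_cases h : (X.C α β).Nonempty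
  · obtain ⟨y, x, hy, hx⟩ := h
    exact BooleanSubalgebra.subset_closure
      ⟨α, mem_language hx, β, mem_language (hy ▸ y.2), rfl⟩
  · rw [Set.not_nonempty_iff_eq_empty.1 h]
    exact BooleanSubalgebra.bot_mem

/-- The set `{β x ∈ X : α x ∈ A}`. -/
def transport (α β : List 𝒜) (A : Set X.Point) : Set X.Point :=
  {y | ∃ x : Stream' 𝒜, y.1 = β ++ₛ x ∧ ∃ z ∈ A, z.1 = α ++ₛ x}

theorem transport_univ (α β : List 𝒜) : transport α β Set.univ = X.C α β := by
  ext y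
  constructor
  · rintro ⟨x, h, z, -, hz⟩
    exact ⟨x, h, hz ▸ z.2⟩
  · rintro ⟨x, h, hz⟩
    exact ⟨x, h, ⟨_, hz⟩, trivial, rfl⟩

theorem transport_compl (α β : List 𝒜) (A : Set X.Point) :
    transport α β Aᶜ = X.C α β ∩ (transport α β A)ᶜ := by
  ext y
  constructor
  · rintro ⟨x, h, z, hzA, hz⟩
    refine ⟨⟨x, h, hz ▸ z.2⟩, ?_⟩
    rintro ⟨x', h', z', hzA', hz'⟩
    have : x = x' := Stream'.append_right_injective _ _ _ (h.symm.trans h')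
    subst this
    exact hzA ((Subtype.ext (hz.trans hz'.symm) : z = z') ▸ hzA')
  · rintro ⟨⟨x, h, hx⟩, hn⟩
    exact ⟨x, h, ⟨_, hx⟩, fun hA => hn ⟨x, h, _, hA, rfl⟩, rfl⟩

theorem transport_union (α β : List 𝒜) (A B : Set X.Point) :
    transport α β (A ∪ B) = transport α β A ∪ transport α β B := by
  ext y
  constructor
  · rintro ⟨x, h, z, hA | hA, hz⟩
    · exact Or.inl ⟨x, h, z, hA, hz⟩
    · exact Or.inr ⟨x, h, z, hA, hz⟩
  · rintro (⟨x, h, z, hA, hz⟩ | ⟨x, h, z, hA, hz⟩)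
    · exact ⟨x, h, z, Or.inl hA, hz⟩
    · exact ⟨x, h, z, Or.inr hA, hz⟩

theorem append_eq_append {α β : List 𝒜} {x y : Stream' 𝒜} (h : α ++ₛ x = β ++ₛ y) :
    (∃ ε, α = β ++ ε ∧ y = ε ++ₛ x) ∨ ∃ ε, β = α ++ ε ∧ x = ε ++ₛ y := by
  induction α generalizing β with
  | nil => exact Or.inr ⟨β, rfl, h⟩
  | cons a α ih =>
    cases β with
    | nil => exact Or.inl ⟨a :: α, rfl, h.symm⟩
    | cons b β =>
      rw [Stream'.cons_append_stream, Stream'.cons_append_stream] at h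
      have h0 : a = b := congrArg Stream'.head h
      have h1 : α ++ₛ x = β ++ₛ y := congrArg Stream'.tail h
      subst h0
      rcases ih h1 with ⟨ε, rfl, hy⟩ | ⟨ε, rfl, hx⟩
      · exact Or.inl ⟨ε, rfl, hy⟩
      · exact Or.inr ⟨ε, rfl, hx⟩

theorem transport_C_mem (α β γ δ : List 𝒜) : transport α β (X.C γ δ) ∈ X.U := by
  by_cases h : ∃ ε, α = δ ++ ε
  · obtain ⟨ε, rfl⟩ := h
    have : transport (δ ++ ε) β (X.C γ δ) = X.C (δ ++ ε) β ∩ X.C (γ ++ ε) β := by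
      ext y
      constructor
      · rintro ⟨x, h, z, ⟨w, hw, hγ⟩, hz⟩
        have hw' : w = ε ++ₛ x := Stream'.append_right_injective δ _ _ (by
          rw [← Stream'.append_append_stream, ← hz, hw])
        exact ⟨⟨x, h, hz ▸ z.2⟩, x, h, by rwa [Stream'.append_append_stream, ← hw']⟩
      · rintro ⟨⟨x, h, hx⟩, x', h', hx'⟩
        obtain rfl : x = x' := Stream'.append_right_injective _ _ _ (h.symm.trans h')
        exact ⟨x, h, ⟨_, hx⟩, ⟨ε ++ₛ x, Stream'.append_append_stream _ _ _,
          by rwa [← Stream'.append_append_stream]⟩, rfl⟩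
    rw [this]
    exact BooleanSubalgebra.inf_mem (C_mem _ _) (C_mem _ _)
  by_cases h' : ∃ ε, δ = α ++ ε
  · obtain ⟨ε, rfl⟩ := h'
    have : transport α β (X.C γ (α ++ ε)) = X.C γ (β ++ ε) ∩ X.C (α ++ ε) (β ++ ε) := by
      ext y
      constructor
      · rintro ⟨x, h, z, ⟨w, hw, hγ⟩, hz⟩
        have hw' : x = ε ++ₛ w := Stream'.append_right_injective α _ _ (by
          rw [← Stream'.append_append_stream, ← hz, hw])
        subst hw'
        exact ⟨⟨w, by rw [h, Stream'.append_append_stream], hγ⟩,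
          w, by rw [h, Stream'.append_append_stream], hw ▸ z.2⟩
      · rintro ⟨⟨w, h, hγ⟩, w', h', hw'⟩
        obtain rfl : w = w' := Stream'.append_right_injective _ _ _ (h.symm.trans h')
        exact ⟨ε ++ₛ w, by rw [h, Stream'.append_append_stream], ⟨_, hw'⟩, ⟨w, rfl, hγ⟩,
          Stream'.append_append_stream _ _ _⟩
    rw [this]
    exact BooleanSubalgebra.inf_mem (C_mem _ _) (C_mem _ _)
  · have : transport α β (X.C γ δ) = ∅ := by
      ext y
      refine ⟨?_, False.elim⟩
      rintro ⟨x, -, z, ⟨w, hw, -⟩, hz⟩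
      rcases append_eq_append (hz.symm.trans hw) with ⟨ε, e, -⟩ | ⟨ε, e, -⟩
      · exact h ⟨ε, e⟩
      · exact h' ⟨ε, e⟩
    rw [this]
    exact BooleanSubalgebra.bot_mem

theorem transport_mem (α β : List 𝒜) {A : Set X.Point} (hA : A ∈ X.U) :
    transport α β A ∈ X.U := by
  induction hA using BooleanSubalgebra.closure_bot_sup_induction with
  | mem A hA =>
    obtain ⟨γ, -, δ, -, rfl⟩ := hA
    exact transport_C_mem α β γ δ
  | bot =>
    have : transport α β (⊥ : Set X.Point) = ⊥ := by
      ext y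
      exact ⟨fun ⟨_, _, _, h, _⟩ => h, False.elim⟩
    rw [this]
    exact BooleanSubalgebra.bot_mem
  | sup A _ B _ hA hB =>
    have : transport α β (A ⊔ B) = transport α β A ⊔ transport α β B := transport_union α β A B
    rw [this]
    exact BooleanSubalgebra.sup_mem hA hB
  | compl A _ hA =>
    rw [transport_compl]
    exact BooleanSubalgebra.inf_mem (C_mem _ _) (BooleanSubalgebra.compl_mem hA)

end Subshift

theorem isReduced_fracWord {𝒜 : Type*} {α β : List 𝒜} :
    FreeGroup.IsReduced (fracWord α β) ↔ ∀ a ∈ α.getLast?, a ∉ β.getLast? := by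
  have h1 : ∀ l : List 𝒜,
      FreeGroup.IsReduced (l.map fun a => (a, true)) ∧
        FreeGroup.IsReduced (l.map fun a => (a, false)).reverse := by
    intro l
    constructor
    · induction l using List.twoStepInduction <;>
        simp_all [FreeGroup.IsReduced]
    · rw [FreeGroup.IsReduced, List.isChain_reverse]
      induction l using List.twoStepInduction <;> simp_all
  rw [fracWord, FreeGroup.IsReduced, List.isChain_append]
  constructor
  · rintro ⟨-, -, h⟩ a ha hb
    have := h (a, true) (by simpa using ha) (a, false) (by simpa using hb) rfl
    simp at this
  · intro h
    refine ⟨(h1 α).1, (h1 β).2, ?_⟩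
    rintro ⟨a, i⟩ ha ⟨b, j⟩ hb rfl
    simp at ha hb
    exact (h a ha.1 hb.1).elim

theorem mk_fracWord {𝒜 : Type*} (α β : List 𝒜) :
    FreeGroup.mk (fracWord α β) =
      FreeGroup.mk (α.map fun a => (a, true)) * (FreeGroup.mk (β.map fun a => (a, true)))⁻¹ := by
  rw [FreeGroup.inv_mk, FreeGroup.mul_mk, fracWord, FreeGroup.invRev]
  simp [Function.comp_def]

theorem mk_fracWord_append {𝒜 : Type*} (α β ε : List 𝒜) :
    FreeGroup.mk (fracWord (α ++ ε) (β ++ ε)) = FreeGroup.mk (fracWord α β) := by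
  simp only [mk_fracWord, List.map_append, ← FreeGroup.mul_mk]
  group

theorem fracWord_injective {𝒜 : Type*} {α β α' β' : List 𝒜}
    (h : fracWord α β = fracWord α' β') : α = α' ∧ β = β' := by
  have h1 := congrArg (fun l => (l.filter (fun p : 𝒜 × Bool => p.2)).map Prod.fst) h
  have h2 := congrArg (fun l => (l.filter (fun p : 𝒜 × Bool => !p.2)).map Prod.fst) h
  simp [fracWord, List.filter_map, Function.comp_def] at h1 h2
  exact ⟨h1, h2⟩

theorem IsReducedForm.unique {𝒜 : Type*} {t : FreeGroup 𝒜} {α β α' β' : List 𝒜}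
    (h : IsReducedForm t α β) (h' : IsReducedForm t α' β') : α = α' ∧ β = β' := by
  classical
  apply fracWord_injective
  rw [← h.2.reduce_eq, ← h'.2.reduce_eq, ← FreeGroup.toWord_mk, ← FreeGroup.toWord_mk, ← h.1, ← h'.1]

theorem IsReducedForm.inv {𝒜 : Type*} {t : FreeGroup 𝒜} {α β : List 𝒜}
    (h : IsReducedForm t α β) : IsReducedForm t⁻¹ β α := by
  refine ⟨?_, ?_⟩
  · rw [h.1, mk_fracWord, mk_fracWord, mul_inv_rev, inv_inv]
  · rw [isReduced_fracWord]
    exact fun a ha hb => isReduced_fracWord.1 h.2 a hb ha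

theorem exists_isReducedForm {𝒜 : Type*} (α β : List 𝒜) :
    ∃ α' β' ε, α = α' ++ ε ∧ β = β' ++ ε ∧ IsReducedForm (FreeGroup.mk (fracWord α β)) α' β' := by
  induction α using List.reverseRecOn generalizing β with
  | nil => exact ⟨[], β, [], rfl, by simp, rfl, isReduced_fracWord.2 (by simp)⟩
  | append_singleton α a ih =>
    by_cases h : FreeGroup.IsReduced (fracWord (α ++ [a]) β)
    · exact ⟨_, _, [], by simp, by simp, rfl, h⟩
    · rw [isReduced_fracWord] at h
      push Not at h
      obtain ⟨b, hb, hβ⟩ := h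
      obtain rfl : a = b := by simpa using hb
      obtain ⟨β, rfl⟩ : ∃ β₀, β = β₀ ++ [a] := by
        rw [Option.mem_def, List.getLast?_eq_some_iff] at hβ
        exact hβ
      obtain ⟨α', β', ε, rfl, rfl, hr⟩ := ih β
      exact ⟨α', β', ε ++ [a], by simp, by simp, by rwa [mk_fracWord_append]⟩

namespace Subshift

variable {𝒜 : Type*} {X : Subshift 𝒜}

/-- The partial map `β z ↦ α z` of the subshift defined by `t = α β⁻¹`, as a relation. -/
def tau (t : FreeGroup 𝒜) (x y : X.Point) : Prop :=
  ∃ (α β : List 𝒜) (z : Stream' 𝒜),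
    t = FreeGroup.mk (fracWord α β) ∧ x.1 = β ++ₛ z ∧ y.1 = α ++ₛ z

theorem tau_mul {s t : FreeGroup 𝒜} {x y w : X.Point} (h : tau t x y) (h' : tau s y w) :
    tau (s * t) x w := by
  obtain ⟨α, β, z, rfl, hx, hy⟩ := h
  obtain ⟨γ, δ, z', rfl, hy', hw⟩ := h'
  rcases append_eq_append (hy.symm.trans hy') with ⟨ε, rfl, rfl⟩ | ⟨ε, rfl, rfl⟩
  · refine ⟨γ ++ ε, β, z, ?_, hx, by rw [hw, Stream'.append_append_stream]⟩
    simp only [mk_fracWord, List.map_append, ← FreeGroup.mul_mk]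
    group
  · refine ⟨γ, β ++ ε, z', ?_, by rw [hx, Stream'.append_append_stream], hw⟩
    simp only [mk_fracWord, List.map_append, ← FreeGroup.mul_mk]
    group

theorem exists_reduced_of_tau {t : FreeGroup 𝒜} {x y : X.Point} (h : tau t x y) :
    ∃ α β z, α ∈ X.language ∧ β ∈ X.language ∧ IsReducedForm t α β ∧
      x.1 = β ++ₛ z ∧ y.1 = α ++ₛ z := by
  obtain ⟨α, β, z, rfl, hx, hy⟩ := h
  obtain ⟨α', β', ε, rfl, rfl, hr⟩ := exists_isReducedForm α β
  rw [Stream'.append_append_stream] at hx hy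
  exact ⟨α', β', ε ++ₛ z, mem_language (hy ▸ y.2), mem_language (hx ▸ x.2), hr, hx, hy⟩

/-- The preimage of a set under the partial map defined by `t`. -/
def tauPre (t : FreeGroup 𝒜) (A : Set X.Point) : Set X.Point := {x | ∃ y ∈ A, tau t x y}

theorem tauPre_eq_transport {t : FreeGroup 𝒜} {α β : List 𝒜} (h : IsReducedForm t α β)
    (A : Set X.Point) : tauPre t A = transport α β A := by
  ext x
  constructor
  · rintro ⟨y, hA, ht⟩
    obtain ⟨α', β', z, -, -, hr, hx, hy⟩ := exists_reduced_of_tau ht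
    obtain ⟨rfl, rfl⟩ := h.unique hr
    exact ⟨z, hx, y, hA, hy⟩
  · rintro ⟨z, hx, y, hA, hy⟩
    exact ⟨y, hA, α, β, z, h.1, hx, hy⟩

theorem tauPre_eq_empty {t : FreeGroup 𝒜}
    (h : ¬ ∃ α ∈ X.language, ∃ β ∈ X.language, IsReducedForm t α β) (A : Set X.Point) :
    tauPre t A = ∅ := by
  ext x
  refine ⟨?_, False.elim⟩
  rintro ⟨y, -, ht⟩
  obtain ⟨α, β, -, hα, hβ, hr, -⟩ := exists_reduced_of_tau ht
  exact h ⟨α, hα, β, hβ, hr⟩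

theorem tauPre_mem (t : FreeGroup 𝒜) {A : Set X.Point} (hA : A ∈ X.U) : tauPre t A ∈ X.U := by
  by_cases h : ∃ α ∈ X.language, ∃ β ∈ X.language, IsReducedForm t α β
  · obtain ⟨α, -, β, -, hr⟩ := h
    rw [tauPre_eq_transport hr]
    exact transport_mem α β hA
  · rw [tauPre_eq_empty h]
    exact BooleanSubalgebra.bot_mem

/-- `tauPre t` as a map of the Boolean algebra `𝒰`. -/
def pull (t : FreeGroup 𝒜) (A : X.U) : X.U := ⟨tauPre t A, tauPre_mem t A.2⟩

theorem mem_V_inv_iff {t : FreeGroup 𝒜} {ξ : X.hatU} : ξ ∈ X.V t⁻¹ ↔ pull t ⊤ ∈ ξ.carrier := by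
  constructor
  · rintro ⟨α, -, β, -, hr, A, hA, hξ⟩
    have hr' := hr.inv
    rw [inv_inv] at hr'
    have : pull t ⊤ = A := Subtype.ext (by
      rw [hA, ← transport_univ, ← tauPre_eq_transport hr']; rfl)
    rwa [this]
  · intro h
    by_cases h' : ∃ α ∈ X.language, ∃ β ∈ X.language, IsReducedForm t α β
    · obtain ⟨α, hα, β, hβ, hr⟩ := h'
      exact ⟨α, hα, β, hβ, hr.inv, pull t ⊤, by
        rw [← transport_univ, ← tauPre_eq_transport hr]; rfl, h⟩
    · exact (ξ.bot_notMem ((Subtype.ext (tauPre_eq_empty h' _) : pull t ⊤ = ⊥) ▸ h)).elim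

theorem mem_phiCarrier_iff {t : FreeGroup 𝒜} {ξ : X.hatU} (hξ : ξ ∈ X.V t⁻¹) {A : X.U} :
    A ∈ X.phiCarrier t ξ ↔ pull t A ∈ ξ.carrier := by
  have hdom := mem_V_inv_iff.1 hξ
  constructor
  · rintro ⟨α, -, β, -, hr, B, hB, hsub⟩
    refine ξ.mem_of_le _ (ξ.inf_mem _ hdom _ hB) _ ?_
    rintro x ⟨hx, hxB⟩
    change x ∈ tauPre t A
    replace hx : x ∈ tauPre t Set.univ := hx
    rw [tauPre_eq_transport hr] at hx ⊢
    obtain ⟨z, hxz, y, -, hy⟩ := hx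
    have hz : z ∈ X.carrier := append_mem (hy ▸ y.2)
    obtain ⟨y', hA, hy'⟩ := hsub (show (⟨z, hz⟩ : X.Point) ∈ X.relRange B β from ⟨x, hxB, hxz⟩)
    exact ⟨z, hxz, y', hA, hy'⟩
  · intro h
    obtain ⟨β, hβ, α, hα, hr, -⟩ := id hξ
    have hr' := hr.inv
    rw [inv_inv] at hr'
    refine ⟨_, ‹_›, _, ‹_›, hr', _, h, ?_⟩
    rintro z ⟨x, hx, hxz⟩
    replace hx : x ∈ tauPre t A := hx
    rw [tauPre_eq_transport hr'] at hx
    obtain ⟨z', hxz', y, hA, hy⟩ := hx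
    obtain rfl : z.1 = z' := Stream'.append_right_injective _ _ _ (hxz.symm.trans hxz')
    exact ⟨y, hA, hy⟩

theorem tau_unique {t : FreeGroup 𝒜} {x y y' : X.Point} (h : tau t x y) (h' : tau t x y') :
    y = y' := by
  obtain ⟨α, β, z, -, -, hr, hx, hy⟩ := exists_reduced_of_tau h
  obtain ⟨α', β', z', -, -, hr', hx', hy'⟩ := exists_reduced_of_tau h'
  obtain ⟨rfl, rfl⟩ := hr.unique hr'
  obtain rfl : z = z' := Stream'.append_right_injective _ _ _ (hx.symm.trans hx')
  exact Subtype.ext (hy.trans hy'.symm)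

theorem pull_mono (t : FreeGroup 𝒜) {A B : X.U} (h : A ≤ B) : pull t A ≤ pull t B := by
  rintro x ⟨y, hA, ht⟩
  exact ⟨y, h hA, ht⟩

theorem isReducedForm_one {𝒜 : Type*} : IsReducedForm (1 : FreeGroup 𝒜) [] [] :=
  ⟨rfl, FreeGroup.IsReduced.nil⟩

theorem pull_one (A : X.U) : pull 1 A = A := by
  apply Subtype.ext
  change tauPre 1 (A : Set X.Point) = A
  rw [tauPre_eq_transport isReducedForm_one]
  ext x
  constructor
  · rintro ⟨z, hx, y, hA, hy⟩
    exact (Subtype.ext (hx.trans hy.symm) : x = y) ▸ hA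
  · exact fun hx => ⟨x.1, rfl, x, hx, rfl⟩

theorem pull_pull_le (s t : FreeGroup 𝒜) (A : X.U) : pull t (pull s A) ≤ pull (s * t) A := by
  rintro x ⟨y, ⟨w, hA, hs⟩, ht⟩
  exact ⟨w, hA, tau_mul ht hs⟩

variable (X) in
/-- The ultrafilter `φ̂_t(ξ)`, for `ξ ∈ V_{t⁻¹}`. -/
def phi (t : FreeGroup 𝒜) (ξ : X.hatU) (hξ : ξ ∈ X.V t⁻¹) : X.hatU where
  carrier := X.phiCarrier t ξ
  top_mem := by
    rw [mem_phiCarrier_iff hξ]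
    exact mem_V_inv_iff.1 hξ
  bot_notMem := by
    rw [mem_phiCarrier_iff hξ]
    intro h
    refine ξ.bot_notMem (ξ.mem_of_le _ h _ ?_)
    rintro x ⟨y, hy, -⟩
    exact hy
  inf_mem := by
    intro A hA B hB
    rw [mem_phiCarrier_iff hξ] at hA hB ⊢
    refine ξ.mem_of_le _ (ξ.inf_mem _ hA _ hB) _ ?_
    rintro x ⟨⟨y, hy, ht⟩, y', hy', ht'⟩
    obtain rfl := tau_unique ht ht'
    exact ⟨y, ⟨hy, hy'⟩, ht⟩
  mem_of_le := by
    intro A hA B hAB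
    rw [mem_phiCarrier_iff hξ] at hA ⊢
    exact ξ.mem_of_le _ hA _ (pull_mono t hAB)
  mem_or_compl_mem := by
    intro A
    rw [mem_phiCarrier_iff hξ, mem_phiCarrier_iff hξ]
    refine (ξ.mem_or_compl_mem (pull t A)).imp_right fun h => ?_
    refine ξ.mem_of_le _ (ξ.inf_mem _ (mem_V_inv_iff.1 hξ) _ h) _ ?_
    rintro x ⟨⟨y, -, ht⟩, hx⟩
    exact ⟨y, fun hy => hx ⟨y, hy, ht⟩, ht⟩

theorem mem_phi_iff {t : FreeGroup 𝒜} {ξ : X.hatU} (hξ : ξ ∈ X.V t⁻¹) {A : X.U} :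
    A ∈ (X.phi t ξ hξ).carrier ↔ pull t A ∈ ξ.carrier :=
  mem_phiCarrier_iff hξ

theorem tau_inv {t : FreeGroup 𝒜} {x y : X.Point} (h : tau t x y) : tau t⁻¹ y x := by
  obtain ⟨α, β, z, rfl, hx, hy⟩ := h
  exact ⟨β, α, z, by rw [mk_fracWord, mk_fracWord, mul_inv_rev, inv_inv], hy, hx⟩

theorem V_eq_basicOpen (t : FreeGroup 𝒜) : X.V t = StoneDual.basicOpen (pull t⁻¹ ⊤) := by
  ext ξ
  have h := mem_V_inv_iff (t := t⁻¹) (ξ := ξ)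
  rwa [inv_inv] at h

open Classical in
variable (X) in
/-- The partial action `φ̂` of the free group on the Stone dual of `𝒰`. -/
noncomputable def hatAction : TopPartialAction (FreeGroup 𝒜) X.hatU where
  dom := X.V
  map t ξ := if hξ : ξ ∈ X.V t⁻¹ then X.phi t ξ hξ else ξ
  isOpen_dom t := by
    rw [V_eq_basicOpen]
    exact StoneDual.isOpen_basicOpen _
  map_mem t ξ hξ := by
    rw [dif_pos hξ, V_eq_basicOpen]
    change pull t⁻¹ ⊤ ∈ (X.phi t ξ hξ).carrier
    rw [mem_phi_iff]
    refine ξ.mem_of_le _ (mem_V_inv_iff.1 hξ) _ ?_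
    rintro x ⟨y, -, ht⟩
    exact ⟨y, ⟨x, trivial, tau_inv ht⟩, ht⟩
  continuousOn_map t := by
    rw [continuousOn_iff_continuous_domRestrict]
    refine continuous_generateFrom_iff.2 ?_
    rintro _ ⟨A, rfl⟩
    convert (StoneDual.isOpen_basicOpen (pull t A)).preimage continuous_subtype_val using 1
    ext ⟨ξ, hξ⟩
    simp only [Set.mem_preimage, Set.domRestrict_apply, dif_pos hξ]
    exact mem_phi_iff hξ
  dom_one := by
    ext ξ
    have h := mem_V_inv_iff (t := 1) (ξ := ξ)
    rw [inv_one, pull_one] at h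
    simpa [h] using ξ.top_mem
  map_one ξ := by
    by_cases hξ : ξ ∈ X.V 1⁻¹
    · rw [dif_pos hξ]
      refine StoneDual.eq_of_subset fun A hA => ?_
      rwa [mem_phi_iff, pull_one] at hA
    · rw [dif_neg hξ]
  map_mul s t ξ hξ hs := by
    rw [dif_pos hξ] at hs ⊢
    have hst : ξ ∈ X.V (s * t)⁻¹ := by
      rw [mem_V_inv_iff, mem_phi_iff] at hs
      exact mem_V_inv_iff.2 (ξ.mem_of_le _ hs _ (pull_pull_le s t ⊤))
    refine ⟨hst, ?_⟩
    rw [dif_pos hs, dif_pos hst]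
    symm
    refine StoneDual.eq_of_subset fun A hA => ?_
    rw [mem_phi_iff, mem_phi_iff] at hA
    exact (mem_phi_iff hst).2 (ξ.mem_of_le _ hA _ (pull_pull_le s t A))

variable (X) in
/-- The transformation groupoid `𝔽 ⋉ 𝒰̂` of the subshift. -/
noncomputable def groupoid : TopGroupoid X.hatAction.Arrow :=
  X.hatAction.transformationGroupoid

end Subshift

-- The singletons {x} of eventually periodic points x are the link between all the conditions.
-- Condition (L) concerns them because `𝒰` is coarse near x = αβ^∞: for every A in `𝒰` there are n
-- and a finite P with β^∞ ∈ F_P such that αβ^n F_P lies in A or in its complement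
-- (`exists_prefixSubset`). If {x} ∈ `𝒰`, this forces F_P = {β^∞}, against (L). Conversely, F_P is
-- itself in `𝒰`, so a failure of (L) puts a periodic singleton into `𝒰`. Topological freeness
-- concerns them because every nonempty basic set O_A contains the principal ultrafilters of the
-- points of A, on which `hatAction` is the partial map βz ↦ αz of X. A nontrivial αβ⁻¹ fixes at
-- most one point of X, and that point is eventually periodic (`exists_of_tau_self`). So if αβ⁻¹
-- fixes O_A pointwise, then A is such a singleton. In the other direction every eventually periodic
-- point is fixed by some nontrivial group element. The rest is general: effectiveness of a
-- transformation groupoid is topological freeness since labels are discrete, and topological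
-- principality follows by Baire category when the group is countable, the space is compact
-- Hausdorff and the domains are clopen.

-- Topological freeness, effectiveness and principality for general partial actions

namespace TopPartialAction

variable {G Z : Type*} [Group G] [TopologicalSpace Z] (θ : TopPartialAction G Z)

/-- The arrow with label `g` and source `x`. -/
def arrow (g : G) (x : θ.dom g⁻¹) : θ.Arrow := ⟨(θ.map g x, g, x), x.2, rfl⟩

theorem continuous_arrow (g : G) : Continuous (θ.arrow g) := by
  let _ : TopologicalSpace G := ⊥
  have h : Continuous fun x : θ.dom g⁻¹ => θ.map g x :=
    continuousOn_iff_continuous_domRestrict.1 (θ.continuousOn_map g)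
  exact continuous_induced_rng.2 (h.prodMk (continuous_const.prodMk continuous_subtype_val))

theorem continuous_unitArrow : Continuous θ.unitArrow := by
  let _ : TopologicalSpace G := ⊥
  exact continuous_induced_rng.2 (continuous_id.prodMk (continuous_const.prodMk continuous_id))

theorem continuous_sourcePoint : Continuous fun p : θ.Arrow => p.1.2.2 := by
  let _ : TopologicalSpace G := ⊥
  have hv : Continuous (Subtype.val : θ.Arrow → Z × G × Z) := continuous_induced_dom
  exact hv.snd.snd

theorem isOpen_setOf_label_eq (g : G) : IsOpen {p : θ.Arrow | p.1.2.1 = g} := by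
  let _ : TopologicalSpace G := ⊥
  have _ : DiscreteTopology G := ⟨rfl⟩
  have hv : Continuous (Subtype.val : θ.Arrow → Z × G × Z) := continuous_induced_dom
  exact (isOpen_discrete {g}).preimage hv.snd.fst

theorem unitArrow_injective : Function.Injective θ.unitArrow :=
  fun _ _ h => congrArg (fun p : θ.Arrow => p.1.1) h

theorem mem_units_iff {p : θ.Arrow} : p ∈ θ.transformationGroupoid.units ↔ p.1.2.1 = 1 := by
  constructor
  · intro h
    exact (congrArg (fun p : θ.Arrow => p.1.2.1) h).symm
  · obtain ⟨⟨x, g, y⟩, hy, hx⟩ := p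
    rintro rfl
    refine Subtype.ext (Prod.ext ?_ rfl)
    exact ((hx : x = θ.map 1 y).trans (θ.map_one y)).symm

theorem unitArrow_mem_units (x : Z) : θ.unitArrow x ∈ θ.transformationGroupoid.units := rfl

theorem mem_iso_iff {p : θ.Arrow} : p ∈ θ.transformationGroupoid.iso ↔ p.1.1 = p.1.2.2 :=
  θ.unitArrow_injective.eq_iff

theorem unitArrow_mem_unitsWithTrivialIsotropy {x : Z}
    (h : ∀ g : G, g ≠ 1 → x ∈ θ.dom g⁻¹ → θ.map g x ≠ x) :
    θ.unitArrow x ∈ θ.transformationGroupoid.unitsWithTrivialIsotropy := by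
  refine ⟨rfl, fun p hs hr => ?_⟩
  have hs : p.1.2.2 = x := θ.unitArrow_injective hs
  have hr : p.1.1 = x := θ.unitArrow_injective hr
  have hp : p.1.2.1 = 1 := by
    by_contra hne
    exact h _ hne (hs ▸ p.2.1) (hs ▸ p.2.2.symm.trans (hr.trans hs.symm))
  rw [← hs]
  exact (θ.mem_units_iff.2 hp).symm

/-- An open set of fixed points of a nontrivial group element is empty. -/
theorem isTopologicallyFree_iff : θ.IsTopologicallyFree ↔
    ∀ (g : G) (W : Set Z), IsOpen W → W ⊆ θ.dom g⁻¹ → (∀ x ∈ W, θ.map g x = x) →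
      W.Nonempty → g = 1 := by
  constructor
  · rintro h g W hW hdom hfix ⟨x, hx⟩
    by_contra hg
    obtain ⟨y, hy, -, hne⟩ := mem_closure_iff.1 (h g hg (hdom hx)) W hW hx
    exact hne (hfix y hy)
  · intro h g hg x hx
    by_contra hcl
    obtain ⟨W, hW, hxW, hne⟩ : ∃ W, IsOpen W ∧ x ∈ W ∧
        ¬ (W ∩ {x | x ∈ θ.dom g⁻¹ ∧ θ.map g x ≠ x}).Nonempty := by
      simpa [mem_closure_iff] using hcl
    refine hg (h g (W ∩ θ.dom g⁻¹) (hW.inter (θ.isOpen_dom _)) Set.inter_subset_right ?_ ⟨x, hxW, hx⟩)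
    rintro y ⟨hyW, hy⟩
    by_contra hy'
    exact hne ⟨y, hyW, hy, hy'⟩

/-- Arrows with a fixed label g form an open set, and x ↦ (gx, g, x) is a continuous section over
the open domain. Hence open sets of isotropy arrows with label g correspond to open sets of fixed
points of g, and the units are the open slice g = 1. -/
theorem isEffective_iff_isTopologicallyFree :
    θ.transformationGroupoid.IsEffective ↔ θ.IsTopologicallyFree := by
  rw [isTopologicallyFree_iff]
  constructor
  · rintro h g W hW hdom hfix ⟨x, hx⟩
    have hopen : IsOpen {p : θ.Arrow | p.1.2.1 = g ∧ p.1.2.2 ∈ W} :=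
      (θ.isOpen_setOf_label_eq g).inter (hW.preimage θ.continuous_sourcePoint)
    have hsub : {p : θ.Arrow | p.1.2.1 = g ∧ p.1.2.2 ∈ W} ⊆ θ.transformationGroupoid.iso := by
      rintro p ⟨rfl, hp⟩
      exact θ.mem_iso_iff.2 (p.2.2.trans (hfix _ hp))
    have hmem : θ.arrow g ⟨x, hdom hx⟩ ∈ interior θ.transformationGroupoid.iso :=
      interior_maximal hsub hopen ⟨rfl, hx⟩
    rw [h] at hmem
    exact θ.mem_units_iff.1 hmem
  · intro h
    refine Set.Subset.antisymm (fun p hp => ?_) (interior_maximal (fun p hp => ?_) ?_)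
    -- The sources of the interior isotropy arrows having the label of `p` form an open set of fixed
    -- points of that label.
    · have hW := isOpen_interior.preimage (θ.continuous_arrow p.1.2.1)
        (t := interior θ.transformationGroupoid.iso)
      refine θ.mem_units_iff.2 (h p.1.2.1 _ ((θ.isOpen_dom _).isOpenMap_subtype_val _ hW) ?_ ?_
        ⟨p.1.2.2, ⟨p.1.2.2, p.2.1⟩, ?_, rfl⟩)
      · rintro _ ⟨x, -, rfl⟩
        exact x.2
      · rintro _ ⟨x, hx, rfl⟩
        exact θ.mem_iso_iff.1 (interior_subset hx)
      · have : θ.arrow p.1.2.1 ⟨p.1.2.2, p.2.1⟩ = p :=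
          Subtype.ext (Prod.ext p.2.2.symm rfl)
        rwa [Set.mem_preimage, this]
    · exact congrArg θ.unitArrow (congrArg (fun q : θ.Arrow => q.1.1) hp).symm
    · convert θ.isOpen_setOf_label_eq 1 using 1
      exact Set.ext fun p => θ.mem_units_iff

/-- If g fixes W pointwise, a unit over W with trivial isotropy must equal the isotropy arrow with
label g, so g = 1. -/
theorem IsTopologicallyFree.of_isTopologicallyPrincipal
    (h : θ.transformationGroupoid.IsTopologicallyPrincipal) : θ.IsTopologicallyFree := by
  rw [isTopologicallyFree_iff]
  rintro g W hW hdom hfix ⟨x, hx⟩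
  obtain ⟨p, hpW, hp, htriv⟩ := mem_closure_iff.1 (h (θ.unitArrow_mem_units x)) _
    (hW.preimage θ.continuous_sourcePoint) hx
  have hps : θ.unitArrow p.1.2.2 = p := hp
  have hgp := htriv (θ.arrow g ⟨p.1.2.2, hdom hpW⟩) hps
    ((congrArg θ.unitArrow (hfix _ hpW)).trans hps)
  exact (congrArg (fun q : θ.Arrow => q.1.2.1) hgp).trans (θ.mem_units_iff.1 hp)

theorem IsTopologicallyFree.isTopologicallyPrincipal [Countable G] [T2Space Z] [BaireSpace Z]
    (hclosed : ∀ g, IsClosed (θ.dom g)) (h : θ.IsTopologicallyFree) :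
    θ.transformationGroupoid.IsTopologicallyPrincipal := by
  -- The complement of the domain is added to make `M g` dense in the whole space; it is open
  -- because the domain is closed. A point in every `M g` has trivial isotropy, and the Baire
  -- property makes such points dense.
  let M (g : {g : G // g ≠ 1}) : Set Z :=
    (θ.dom g.1⁻¹)ᶜ ∪ {x | x ∈ θ.dom g.1⁻¹ ∧ θ.map g.1 x ≠ x}
  have hopen (g) : IsOpen (M g) := by
    refine (hclosed _).isOpen_compl.union ?_
    have hne : IsOpen {x : θ.dom g.1⁻¹ | θ.map g.1 x ≠ x} :=
      isOpen_ne_fun (continuousOn_iff_continuous_domRestrict.1 (θ.continuousOn_map g.1))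
        continuous_subtype_val
    convert (θ.isOpen_dom g.1⁻¹).isOpenMap_subtype_val _ hne using 1
    ext x
    simp [and_comm]
  have hdense (g) : Dense (M g) := by
    intro x
    by_cases hx : x ∈ θ.dom g.1⁻¹
    · exact closure_mono Set.subset_union_right (h g.1 g.2 hx)
    · exact subset_closure (Or.inl hx)
  have hD : Dense (⋂ g, M g) := dense_iInter_of_isOpen hopen hdense
  intro p hp
  have hps : θ.unitArrow p.1.2.2 = p := hp
  rw [← hps]
  refine closure_mono ?_ (image_closure_subset_closure_image θ.continuous_unitArrow
    ⟨_, hD p.1.2.2, rfl⟩)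
  rintro _ ⟨x, hx, rfl⟩
  refine θ.unitArrow_mem_unitsWithTrivialIsotropy fun g hg hxg => ?_
  exact ((Set.mem_iInter.1 hx ⟨g, hg⟩).resolve_left fun hn => hn hxg).2

end TopPartialAction

-- The Stone dual is a compact Hausdorff space

namespace StoneDual

variable {B : Type*} [BooleanAlgebra B]

theorem compl_mem_iff {ξ : StoneDual B} {a : B} : aᶜ ∈ ξ.carrier ↔ a ∉ ξ.carrier := by
  refine ⟨fun hc ha => ξ.bot_notMem ?_, (ξ.mem_or_compl_mem a).resolve_left⟩
  simpa using ξ.inf_mem _ ha _ hc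

theorem inf_mem_iff {ξ : StoneDual B} {a b : B} :
    a ⊓ b ∈ ξ.carrier ↔ a ∈ ξ.carrier ∧ b ∈ ξ.carrier :=
  ⟨fun h => ⟨ξ.mem_of_le _ h _ inf_le_left, ξ.mem_of_le _ h _ inf_le_right⟩,
    fun h => ξ.inf_mem _ h.1 _ h.2⟩

theorem basicOpen_compl (a : B) : basicOpen aᶜ = (basicOpen a)ᶜ :=
  Set.ext fun _ => compl_mem_iff

theorem isClosed_basicOpen (a : B) : IsClosed (basicOpen a) := by
  rw [← isOpen_compl_iff, ← basicOpen_compl]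
  exact isOpen_basicOpen _

theorem isTopologicalBasis_basicOpen :
    TopologicalSpace.IsTopologicalBasis (Set.range (basicOpen : B → Set (StoneDual B))) where
  exists_subset_inter := by
    rintro _ ⟨a, rfl⟩ _ ⟨b, rfl⟩ ξ ⟨ha, hb⟩
    exact ⟨_, ⟨a ⊓ b, rfl⟩, inf_mem_iff.2 ⟨ha, hb⟩, fun η h => inf_mem_iff.1 h⟩
  sUnion_eq := Set.eq_univ_of_forall fun ξ => ⟨_, ⟨⊤, rfl⟩, ξ.top_mem⟩
  eq_generateFrom := rfl

instance : T2Space (StoneDual B) where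
  t2 ξ η hne := by
    obtain ⟨a, ha, ha'⟩ := Set.not_subset.1 fun h => hne (eq_of_subset h)
    refine ⟨_, _, isOpen_basicOpen a, isOpen_basicOpen aᶜ, ha, compl_mem_iff.2 ha', ?_⟩
    rw [basicOpen_compl]
    exact disjoint_compl_right

/-- The limit of an ultrafilter of points of the Stone dual. -/
def limit (F : Ultrafilter (StoneDual B)) : StoneDual B where
  carrier := {a | basicOpen a ∈ F}
  top_mem := Filter.mem_of_superset Filter.univ_mem fun ξ _ => ξ.top_mem
  bot_notMem h := by
    obtain ⟨ξ, hξ⟩ := F.nonempty_of_mem h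
    exact ξ.bot_notMem hξ
  inf_mem a ha b hb := Filter.mem_of_superset (Filter.inter_mem ha hb)
    fun _ h => inf_mem_iff.2 h
  mem_of_le a ha b hab := Filter.mem_of_superset ha fun ξ h => ξ.mem_of_le _ h _ hab
  mem_or_compl_mem a := by
    change basicOpen a ∈ F ∨ basicOpen aᶜ ∈ F
    rw [basicOpen_compl]
    exact F.mem_or_compl_mem _

/-- Every ultrafilter F on the Stone dual converges to `limit F`. Together with the Hausdorff
property this supplies the Baire property. -/
instance : CompactSpace (StoneDual B) := by
  refine ⟨isCompact_iff_ultrafilter_le_nhds.2 fun F _ => ⟨limit F, trivial, ?_⟩⟩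
  rw [TopologicalSpace.nhds_generateFrom]
  refine le_iInf₂ fun s hs => ?_
  obtain ⟨hmem, a, rfl⟩ := hs
  exact Filter.le_principal_iff.2 hmem

end StoneDual

-- Periodic sequences

namespace Stream'

variable {𝒜 : Type*}

theorem eq_flatten_replicate_append {x : Stream' 𝒜} {β : List 𝒜} (h : x = β ++ₛ x) (n : ℕ) :
    x = (List.replicate n β).flatten ++ₛ x := by
  induction n with
  | zero => rfl
  | succ n ih =>
    rw [List.replicate_succ, List.flatten_cons, append_append_stream, ← ih]
    exact h

theorem take_eq_take_of_eq_append {w : List 𝒜} {x y x' y' : Stream' 𝒜} {n : ℕ} (hn : n ≤ w.length)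
    (hx : x = w ++ₛ x') (hy : y = w ++ₛ y') : x.take n = y.take n := by
  rw [hx, hy, take_append_of_le_length _ _ _ hn, take_append_of_le_length _ _ _ hn]

theorem le_length_flatten_replicate {β : List 𝒜} (hβ : β ≠ []) (n : ℕ) :
    n ≤ (List.replicate n β).flatten.length := by
  have : 0 < β.length := List.length_pos_iff.2 hβ
  rw [List.length_flatten, List.map_replicate, List.sum_replicate, smul_eq_mul]
  exact Nat.le_mul_of_pos_right n this

/-- Both sequences begin with every power of β, and these powers are arbitrarily long. -/
theorem eq_cycle {x : Stream' 𝒜} {β : List 𝒜} (hβ : β ≠ []) (h : x = β ++ₛ x) :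
    x = cycle β hβ :=
  take_theorem _ _ fun n => take_eq_take_of_eq_append (le_length_flatten_replicate hβ n)
    (eq_flatten_replicate_append h n) (eq_flatten_replicate_append (cycle_eq β hβ) n)

end Stream'

theorem FreeGroup.mk_fracWord_nil_ne_one {𝒜 : Type*} {β : List 𝒜} (hβ : β ≠ []) :
    FreeGroup.mk (fracWord β []) ≠ 1 := by
  intro h
  have hr : IsReducedForm (1 : FreeGroup 𝒜) β [] :=
    ⟨h.symm, isReduced_fracWord.2 (by simp)⟩
  exact hβ (hr.unique Subshift.isReducedForm_one).1

-- The Boolean algebra near an eventually periodic point, and condition (L)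

namespace Subshift

variable {𝒜 : Type*} {X : Subshift 𝒜}

theorem mem_followerSet_iff {P : Finset (List 𝒜)} {y : X.Point} :
    y ∈ X.followerSet P ↔ ∀ μ ∈ P, μ ++ₛ y.1 ∈ X.carrier := by
  simp only [followerSet, follower, Set.mem_iInter]
  refine forall₂_congr fun μ _ => ⟨?_, fun h => ⟨y.1, rfl, h⟩⟩
  rintro ⟨x, hx, h⟩
  rwa [hx]

theorem followerSet_mem (P : Finset (List 𝒜)) : X.followerSet P ∈ X.U := by
  classical
  induction P using Finset.induction_on with
  | empty =>
    have : X.followerSet ∅ = ⊤ := by simp [followerSet]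
    rw [this]
    exact BooleanSubalgebra.top_mem
  | insert α P _ ih =>
    have : X.followerSet (insert α P) = X.C α [] ⊓ X.followerSet P :=
      Finset.set_biInter_insert _ _ _
    rw [this]
    exact BooleanSubalgebra.inf_mem (C_mem _ _) ih

/-- A sequence outside the subshift has a prefix that does not occur in the subshift. -/
theorem exists_take_notMem {x : Stream' 𝒜} (hx : x ∉ X.carrier) :
    ∃ n, ∀ y : Stream' 𝒜, y.take n = x.take n → y ∉ X.carrier := by
  obtain ⟨F, hF⟩ := X.exists_forbidden
  rw [hF] at hx ⊢
  simp only [Set.mem_ofPred_eq, not_forall, not_not] at hx ⊢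
  obtain ⟨i, n, h⟩ := hx
  refine ⟨i + n, fun y hy => ⟨i, n, ?_⟩⟩
  rwa [Stream'.take_drop, hy, ← Stream'.take_drop]

/-- Every sequence `w z` with `z` in the follower set of `P` belongs to `A`. -/
def PrefixSubset (A : Set X.Point) (w : List 𝒜) (P : Finset (List 𝒜)) : Prop :=
  ∀ z : Stream' 𝒜, (∀ μ ∈ P, μ ++ₛ z ∈ X.carrier) → ∃ y ∈ A, y.1 = w ++ₛ z

open Classical in
-- Substituting εz for z moves ε from the tail into the prefix. This allows two sets to be compared
-- along a common prefix.
theorem PrefixSubset.append {A : Set X.Point} {w : List 𝒜} {P : Finset (List 𝒜)}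
    (h : PrefixSubset A w P) (ε : List 𝒜) : PrefixSubset A (w ++ ε) (P.image (· ++ ε)) := by
  intro z hz
  rw [Stream'.append_append_stream]
  refine h _ fun μ hμ => ?_
  rw [← Stream'.append_append_stream]
  exact hz _ (Finset.mem_image_of_mem _ hμ)

theorem PrefixSubset.mono {A B : Set X.Point} {w : List 𝒜} {P Q : Finset (List 𝒜)}
    (h : PrefixSubset A w P) (hAB : A ⊆ B) (hPQ : P ⊆ Q) : PrefixSubset B w Q := fun z hz =>
  let ⟨y, hy, e⟩ := h z fun μ hμ => hz μ (hPQ hμ)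
  ⟨y, hAB hy, e⟩

theorem PrefixSubset.inter {A B : Set X.Point} {w : List 𝒜} {P : Finset (List 𝒜)}
    (hA : PrefixSubset A w P) (hB : PrefixSubset B w P) : PrefixSubset (A ∩ B) w P := by
  intro z hz
  obtain ⟨y, hy, e⟩ := hA z hz
  obtain ⟨y', hy', e'⟩ := hB z hz
  obtain rfl : y = y' := Subtype.ext (e.trans e'.symm)
  exact ⟨y, ⟨hy, hy'⟩, e⟩

/-- Here `w n` stands for the prefix αβ^n of x = αβ^∞. The generator C(γ, δ) is decided, for all
sequences starting with a long enough `w n`, by finitely many follower conditions that β^∞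
satisfies. -/
theorem exists_prefixSubset_C {w : ℕ → List 𝒜} {β : List 𝒜} (hβ : β ≠ [])
    (hw : ∀ m n, w (m + n) = w m ++ (List.replicate n β).flatten) (hlen : ∀ n, n ≤ (w n).length)
    (hx : ∀ n, w n ++ₛ Stream'.cycle β hβ ∈ X.carrier) (γ δ : List 𝒜) :
    ∃ n, ∃ P : Finset (List 𝒜), (∀ μ ∈ P, μ ++ₛ Stream'.cycle β hβ ∈ X.carrier) ∧
      (PrefixSubset (X.C γ δ) (w n) P ∨ PrefixSubset (X.C γ δ)ᶜ (w n) P) := by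
  classical
  -- With this n the word `w n` is at least as long as δ, so either δ is a prefix of it or no
  -- sequence starting with `w n` starts with δ.
  set n := δ.length with hn
  by_cases hδ : δ <+: w n
  · obtain ⟨ε, hε⟩ := hδ
    by_cases hγ : (γ ++ ε) ++ₛ Stream'.cycle β hβ ∈ X.carrier
    -- Since `w n` = δε, the condition for `w n` makes δεz a point of X, and the condition for γε
    -- gives γεz ∈ X.
    · refine ⟨n, {w n, γ ++ ε}, ?_, Or.inl fun z hz => ?_⟩
      · intro μ hμ
        rcases Finset.mem_insert.1 hμ with rfl | hμ
        · exact hx _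
        · rwa [Finset.mem_singleton.1 hμ]
      · refine ⟨⟨w n ++ₛ z, hz _ (by simp)⟩, ⟨ε ++ₛ z, ?_, ?_⟩, rfl⟩
        · rw [← Stream'.append_append_stream, hε]
        · rw [← Stream'.append_append_stream]
          exact hz _ (by simp)
    -- The first N letters of γεβ^∞ already exclude it from X. Lengthening the prefix by β^N fixes
    -- these letters whatever z is.
    · obtain ⟨N, hN⟩ := exists_take_notMem hγ
      refine ⟨n + N, {w (n + N)}, by simpa using hx _, Or.inr fun z hz => ?_⟩
      refine ⟨⟨w (n + N) ++ₛ z, hz _ (by simp)⟩, ?_, rfl⟩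
      rintro ⟨z', hz', hmem⟩
      refine hN _ ?_ hmem
      have e : z' = ε ++ₛ ((List.replicate N β).flatten ++ₛ z) := by
        apply Stream'.append_right_injective δ
        refine hz'.symm.trans (?_ : w (n + N) ++ₛ z = _)
        rw [hw, ← hε, Stream'.append_append_stream, Stream'.append_append_stream]
      refine Stream'.take_eq_take_of_eq_append (w := γ ++ ε ++ (List.replicate N β).flatten)
        (x' := z) (y' := Stream'.cycle β hβ) ?_ ?_ ?_
      · have := Stream'.le_length_flatten_replicate hβ N
        simp only [List.length_append]
        omega
      · rw [e, Stream'.append_append_stream, Stream'.append_append_stream]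
      · rw [Stream'.append_append_stream (γ ++ ε),
          ← Stream'.eq_flatten_replicate_append (Stream'.cycle_eq β hβ)]
  · refine ⟨n, {w n}, by simpa using hx n, Or.inr fun z hz => ?_⟩
    refine ⟨⟨w n ++ₛ z, hz _ (by simp)⟩, ?_, rfl⟩
    rintro ⟨z', hz', -⟩
    rcases append_eq_append hz' with ⟨ε, e, -⟩ | ⟨ε, e, -⟩
    · exact hδ ⟨ε, e.symm⟩
    · have h0 : ε = [] := by
        have h1 := congrArg List.length e
        have h2 := hlen n
        rw [List.length_append] at h1
        exact List.eq_nil_of_length_eq_zero (by omega)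
      exact hδ ⟨[], by rw [e, h0]; simp⟩

/-- The sets decided in this sense are closed under complement by symmetry, and under union after
passing to a common prefix `w (m + n)` and merging the follower conditions. -/
theorem exists_prefixSubset {w : ℕ → List 𝒜} {β : List 𝒜} (hβ : β ≠ [])
    (hw : ∀ m n, w (m + n) = w m ++ (List.replicate n β).flatten) (hlen : ∀ n, n ≤ (w n).length)
    (hx : ∀ n, w n ++ₛ Stream'.cycle β hβ ∈ X.carrier) {A : Set X.Point} (hA : A ∈ X.U) :
    ∃ n, ∃ P : Finset (List 𝒜), (∀ μ ∈ P, μ ++ₛ Stream'.cycle β hβ ∈ X.carrier) ∧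
      (PrefixSubset A (w n) P ∨ PrefixSubset Aᶜ (w n) P) := by
  classical
  induction hA using BooleanSubalgebra.closure_bot_sup_induction with
  | mem A hA =>
    obtain ⟨γ, -, δ, -, rfl⟩ := hA
    exact exists_prefixSubset_C hβ hw hlen hx γ δ
  | bot =>
    refine ⟨0, {w 0}, by simpa using hx 0, Or.inr fun z hz => ?_⟩
    exact ⟨⟨w 0 ++ₛ z, hz _ (by simp)⟩, id, rfl⟩
  | compl A _ ih =>
    obtain ⟨n, P, hP, h⟩ := ih
    refine ⟨n, P, hP, h.symm.imp_right fun h => ?_⟩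
    rwa [compl_compl]
  | sup A _ B _ ihA ihB =>
    obtain ⟨m, P, hP, hA⟩ := ihA
    obtain ⟨n, Q, hQ, hB⟩ := ihB
    -- Since β^k β^∞ = β^∞, appending β^k to the words of R preserves their admissibility before
    -- β^∞.
    have shift : ∀ k (R : Finset (List 𝒜)), (∀ μ ∈ R, μ ++ₛ Stream'.cycle β hβ ∈ X.carrier) →
        ∀ μ ∈ R.image (· ++ (List.replicate k β).flatten),
          μ ++ₛ Stream'.cycle β hβ ∈ X.carrier := by
      intro k R hR μ hμ
      obtain ⟨ν, hν, rfl⟩ := Finset.mem_image.1 hμ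
      rw [Stream'.append_append_stream,
        ← Stream'.eq_flatten_replicate_append (Stream'.cycle_eq β hβ)]
      exact hR ν hν
    have hA' := hA.imp (fun h => h.append (List.replicate n β).flatten)
      (fun h => h.append (List.replicate n β).flatten)
    have hB' := hB.imp (fun h => h.append (List.replicate m β).flatten)
      (fun h => h.append (List.replicate m β).flatten)
    rw [← hw] at hA' hB'
    rw [Nat.add_comm n m] at hB'
    refine ⟨m + n, P.image (· ++ (List.replicate n β).flatten) ∪
      Q.image (· ++ (List.replicate m β).flatten), fun μ hμ => ?_, ?_⟩
    · exact (Finset.mem_union.1 hμ).elim (shift n P hP μ) (shift m Q hQ μ)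
    · rcases hA' with hA' | hA'
      · exact Or.inl (hA'.mono Set.subset_union_left Finset.subset_union_left)
      rcases hB' with hB' | hB'
      · exact Or.inl (hB'.mono Set.subset_union_right Finset.subset_union_right)
      · have := (hA'.mono subset_rfl Finset.subset_union_left).inter
          (hB'.mono subset_rfl Finset.subset_union_right)
        rw [← Set.compl_union] at this
        exact Or.inr this

theorem conditionL_iff_singleton_notMem : X.ConditionL ↔
    ∀ x : X.Point, IsEventuallyPeriodic x.1 → ({x} : Set X.Point) ∉ X.U := by
  constructor
  · rintro hL x ⟨α, β, hβ, hx⟩ hU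
    let w (n : ℕ) : List 𝒜 := α ++ (List.replicate n β).flatten
    have hwx (n) : w n ++ₛ Stream'.cycle β hβ = x.1 := by
      rw [Stream'.append_append_stream,
        ← Stream'.eq_flatten_replicate_append (Stream'.cycle_eq β hβ), hx]
    obtain ⟨n, P, hP, h⟩ := exists_prefixSubset (w := w) hβ
      (fun m n => by
        simp only [w, List.replicate_add, List.flatten_append, List.append_assoc])
      (fun n => by
        have := Stream'.le_length_flatten_replicate hβ n
        simp only [w, List.length_append]
        omega)
      (fun n => (hwx n).symm ▸ x.2) hU
    have hβX : Stream'.cycle β hβ ∈ X.carrier := append_mem (hx ▸ x.2)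
    -- The alternative with the complement fails at z = β^∞, as `w n` followed by β^∞ is x itself.
    replace h : PrefixSubset {x} (w n) P := h.resolve_right fun h => by
      obtain ⟨y, hy, e⟩ := h _ hP
      exact hy (Subtype.ext (e.trans (hwx n)))
    obtain ⟨z, hz, hne⟩ := hL P (fun μ hμ => mem_language (hP μ hμ)) β
      (mem_language (Stream'.cycle_eq β hβ ▸ hβX)) hβ ⟨_, hβX⟩ (mem_followerSet_iff.2 hP) rfl
    -- The second element z of F_P given by (L) would satisfy `w n` z = x, hence z = β^∞.
    obtain ⟨y, rfl, hy⟩ := h z.1 (mem_followerSet_iff.1 hz)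
    exact hne (Subtype.ext (Stream'.append_right_injective _ _ _ (hy.symm.trans (hwx n).symm)))
  · intro h P _ γ _ hγ y hy hyγ
    by_contra! hz
    have : X.followerSet P = {y} := Set.eq_singleton_iff_unique_mem.2 ⟨hy, hz⟩
    exact h y ⟨[], γ, hγ, hyγ⟩ (this ▸ followerSet_mem P)

-- Principal ultrafilters, fixed points and topological freeness

variable (X) in
/-- The principal ultrafilter of a point. -/
def principal (x : X.Point) : X.hatU where
  carrier := {A | x ∈ (A : Set X.Point)}
  top_mem := trivial
  bot_notMem := id
  inf_mem _ ha _ hb := ⟨ha, hb⟩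
  mem_of_le _ ha _ hab := hab ha
  mem_or_compl_mem _ := em _

theorem hatAction_map {t : FreeGroup 𝒜} {ξ : X.hatU} (hξ : ξ ∈ X.V t⁻¹) :
    X.hatAction.map t ξ = X.phi t ξ hξ := dif_pos hξ

/-- The Boolean algebra `𝒰` separates the points of the subshift. -/
theorem principal_injective : Function.Injective X.principal := by
  intro x y h
  refine Subtype.ext (Stream'.take_theorem _ _ fun n => ?_)
  -- C(ω, w) is the cylinder of all points starting with w, here with w the first n letters of x.
  have hx : (⟨X.C [] (x.1.take n), C_mem _ _⟩ : X.U) ∈ (X.principal x).carrier :=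
    ⟨x.1.drop n, (Stream'.append_take_drop n x.1).symm, append_mem (α := x.1.take n) (by
      rw [Stream'.nil_append_stream, Stream'.append_take_drop]; exact x.2)⟩
  rw [h] at hx
  obtain ⟨z, hz, -⟩ := hx
  exact Stream'.take_eq_take_of_eq_append (Stream'.length_take n x.1).ge
    (Stream'.append_take_drop n x.1).symm hz

theorem principal_mem_V_inv_iff {t : FreeGroup 𝒜} {x : X.Point} :
    X.principal x ∈ X.V t⁻¹ ↔ ∃ y, tau t x y := by
  rw [mem_V_inv_iff]
  exact ⟨fun ⟨y, _, h⟩ => ⟨y, h⟩, fun ⟨y, h⟩ => ⟨y, trivial, h⟩⟩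

theorem map_principal {t : FreeGroup 𝒜} {x y : X.Point} (h : tau t x y) :
    X.hatAction.map t (X.principal x) = X.principal y := by
  rw [hatAction_map (principal_mem_V_inv_iff.2 ⟨y, h⟩)]
  refine StoneDual.eq_of_subset fun A hA => ?_
  obtain ⟨y', hy', h'⟩ := (mem_phi_iff _).1 hA
  rwa [tau_unique h h']

/-- A nontrivial element of the free group fixes at most one point, which is eventually periodic. -/
theorem exists_of_tau_self {t : FreeGroup 𝒜} (ht : t ≠ 1) {x : X.Point} (hx : tau t x x) :
    IsEventuallyPeriodic x.1 ∧ ∀ y, tau t y y → y = x := by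
  have key : ∃ (δ ε : List 𝒜) (hε : ε ≠ []), ∀ y : X.Point, tau t y y →
      y.1 = δ ++ₛ Stream'.cycle ε hε := by
    obtain ⟨α, β, z, -, -, hr, hβ, hα⟩ := exists_reduced_of_tau hx
    have hne : α ≠ β := by
      rintro rfl
      refine ht (hr.1.trans ?_)
      rw [mk_fracWord, mul_inv_cancel]
    -- From αz = βz one of α, β is a prefix of the other. If α = βε, every fixed point βz' has z' =
    -- εz', so z' = ε^∞; the other case is symmetric.
    rcases append_eq_append (hα.symm.trans hβ) with ⟨ε, rfl, -⟩ | ⟨ε, rfl, -⟩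
    · refine ⟨β, ε, fun h => hne (by simp [h]), fun y hy => ?_⟩
      obtain ⟨α', β', z', -, -, hr', hβ', hα'⟩ := exists_reduced_of_tau hy
      obtain ⟨rfl, rfl⟩ := hr.unique hr'
      rw [hβ', ← Stream'.eq_cycle (β := ε) (x := z')]
      apply Stream'.append_right_injective β
      rw [← hβ', hα', Stream'.append_append_stream]
    · refine ⟨α, ε, fun h => hne (by simp [h]), fun y hy => ?_⟩
      obtain ⟨α', β', z', -, -, hr', hβ', hα'⟩ := exists_reduced_of_tau hy
      obtain ⟨rfl, rfl⟩ := hr.unique hr'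
      rw [hα', ← Stream'.eq_cycle (β := ε) (x := z')]
      apply Stream'.append_right_injective α
      rw [← hα', hβ', Stream'.append_append_stream]
  obtain ⟨δ, ε, hε, h⟩ := key
  exact ⟨⟨δ, ε, hε, h x hx⟩, fun y hy => Subtype.ext ((h y hy).trans (h x hx).symm)⟩

/-- An eventually periodic point is fixed by a nontrivial element of the free group. -/
theorem exists_tau_self {x : X.Point} (hx : IsEventuallyPeriodic x.1) :
    ∃ t : FreeGroup 𝒜, t ≠ 1 ∧ tau t x x := by
  obtain ⟨α, β, hβ, hx⟩ := hx
  -- The element (αβ)α⁻¹ sends αβ^∞ to αββ^∞, the same point. The word need not be reduced, which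
  -- `tau` permits; being a conjugate of β, the element is nontrivial.
  refine ⟨FreeGroup.mk (fracWord (α ++ β) α), ?_, α ++ β, α, Stream'.cycle β hβ, rfl, hx, ?_⟩
  · intro h
    have h1 := FreeGroup.mk_fracWord_nil_ne_one hβ
    simp only [mk_fracWord, List.map_append, ← FreeGroup.mul_mk, List.map_nil] at h h1
    rw [mul_inv_eq_one, mul_eq_left] at h
    rw [h] at h1
    exact h1 (by simp [← FreeGroup.one_eq_mk])
  · rw [Stream'.append_append_stream, ← Stream'.cycle_eq]
    exact hx

theorem isTopologicallyFree_iff_singleton_notMem : X.hatAction.IsTopologicallyFree ↔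
    ∀ x : X.Point, IsEventuallyPeriodic x.1 → ({x} : Set X.Point) ∉ X.U := by
  rw [TopPartialAction.isTopologicallyFree_iff]
  constructor
  · intro h x hx hU
    obtain ⟨t, ht, htx⟩ := exists_tau_self hx
    -- The set {x} is an atom of `𝒰`, so the principal ultrafilter of x is the only one containing
    -- it and is an isolated point.
    have hξ (ξ : X.hatU) (hmem : (⟨{x}, hU⟩ : X.U) ∈ ξ.carrier) : X.principal x = ξ := by
      refine (StoneDual.eq_of_subset fun A hA => ?_).symm
      by_contra hxA
      refine ξ.bot_notMem (ξ.mem_of_le _ (ξ.inf_mem _ hmem _ hA) _ ?_)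
      rintro y ⟨hyx, hy⟩
      obtain rfl : y = x := hyx
      exact hxA hy
    refine ht (h t (StoneDual.basicOpen ⟨{x}, hU⟩) (StoneDual.isOpen_basicOpen _) ?_ ?_
      ⟨X.principal x, rfl⟩)
    · intro ξ hmem
      rw [← hξ ξ hmem]
      exact principal_mem_V_inv_iff.2 ⟨x, htx⟩
    · intro ξ hmem
      rw [← hξ ξ hmem]
      exact map_principal htx
  · rintro h t W hW hdom hfix ⟨ξ, hξ⟩
    by_contra ht
    obtain ⟨_, ⟨A, rfl⟩, hA, hAW⟩ :=
      StoneDual.isTopologicalBasis_basicOpen.exists_subset_of_mem_open hξ hW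
    -- The principal ultrafilter of x lies in W, so t fixes it, and `principal_injective` carries
    -- this back to X.
    have htau (x : X.Point) (hx : x ∈ (A : Set X.Point)) : tau t x x := by
      have hxW : X.principal x ∈ W := hAW hx
      obtain ⟨y, hy⟩ := principal_mem_V_inv_iff.1 (hdom hxW)
      have := hfix _ hxW
      rw [map_principal hy] at this
      rwa [principal_injective this] at hy
    obtain ⟨x, hx⟩ : (A : Set X.Point).Nonempty := by
      rw [Set.nonempty_iff_ne_empty]
      intro h0
      have : A = ⊥ := Subtype.ext h0
      exact ξ.bot_notMem (this ▸ hA)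
    obtain ⟨hper, huniq⟩ := exists_of_tau_self ht (htau x hx)
    have : (A : Set X.Point) = {x} :=
      Set.eq_singleton_iff_unique_mem.2 ⟨hx, fun y hy => huniq y (htau y hy)⟩
    exact h x hper (this ▸ A.2)

theorem isClosed_V (t : FreeGroup 𝒜) : IsClosed (X.V t) := by
  rw [V_eq_basicOpen]
  exact StoneDual.isClosed_basicOpen _

/-- A countable alphabet makes the free group countable, and the domains are clopen in a compact
Hausdorff space, so the Baire argument applies. -/
theorem isTopologicallyPrincipal_iff_isTopologicallyFree [Countable 𝒜] :
    X.groupoid.IsTopologicallyPrincipal ↔ X.hatAction.IsTopologicallyFree := by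
  exact ⟨TopPartialAction.IsTopologicallyFree.of_isTopologicallyPrincipal _,
    fun h => h.isTopologicallyPrincipal _ isClosed_V⟩

end Subshift

theorem mainTheorem6 {𝒜 : Type*} (X : Subshift 𝒜) :
    List.TFAE
      [X.ConditionL,
        ∀ x : X.Point, IsEventuallyPeriodic x.1 → ({x} : Set X.Point) ∉ X.U,
        X.groupoid.IsEffective,
        X.hatAction.IsTopologicallyFree] ∧
    (Countable 𝒜 → (X.ConditionL ↔ X.groupoid.IsTopologicallyPrincipal)) := by
  refine ⟨?_, fun _ => ?_⟩
  · tfae_have 1 ↔ 2 := Subshift.conditionL_iff_singleton_notMem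
    tfae_have 3 ↔ 4 := X.hatAction.isEffective_iff_isTopologicallyFree
    tfae_have 4 ↔ 2 := Subshift.isTopologicallyFree_iff_singleton_notMem
    tfae_finish
  · rw [Subshift.isTopologicallyPrincipal_iff_isTopologicallyFree,
      Subshift.isTopologicallyFree_iff_singleton_notMem]
    exact Subshift.conditionL_iff_singleton_notMem
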